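/- Let $A$ be a $C^*$-algebra with multiplier algebra $M(A)$. An operator $T$ on the Banach space $A$ with dense linear domain $D(T)\subset A$ is \emph{affiliated with} $A$ if there is $z\in M(A)$ with $\|z\|\le 1$ such that the graph of $T$ equals $\{((1-z^*z)^{1/2}a,\ za): a\in A\}$; this $z$ is unique, is called the $z$-transform of $T$ and is denoted $z(T)$ (it is $T(1+T^*T)^{-1/2}$). For $s\in\mathbb{C}\setminus\{0\}$ write $z_s(T)=z(sT)$. The adjoint $T^*$ is the operator with $x\in D(T^*)$, $T^*x=y$ if and only if $x^*(Ta)=y^*a$ for all $a\in D(T)$; $T$ is normal if $T^*T=TT^*$ (compositions on their natural domains). For operators $X,Y$ on $A$ let $X\circ Y$ have domain $\{a\in D(Y): Ya\in D(X)\}$, and if $X\circ Y$ is closable let $XY$ denote its closure. Let $p,q>0$. A pair $(R,S)$ of normal elements affiliated with $A$ is called a $(p^2,q^2)$-commuting pair if \[ z(R)\,z(S^*)=z_{pq}(S^*)\,z_{q/p}(R)\qquad\text{and}\qquad z_{q/p}(R)\,z(S)=z_{pq}(S)\,z(R). \] \textbf{Theorem.} Let $(R,S)$ be a $(p^2,q^2)$-commuting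 pair of normal elements affiliated with $A$. Then $R\circ S$, $S\circ R$, $R\circ S^*$ and $S^*\circ R$ are closable, their closures $RS$, $SR$, $RS^*$ and $S^*R$ are affiliated with $A$, and \[ RS=p^2\,SR,\qquad RS^*=q^2\,S^*R \] (equality of operators, including their domains). -/

import Mathlib

open scoped MultiplierAlgebra

namespace CStarAffiliated

variable {A : Type*} [NonUnitalCStarAlgebra A]

/-- The multiplier `(1 - z* z)^{1/2}` of `A`, for a multiplier `z` with `‖z‖ ≤ 1`. -/
noncomputable def defect (z : 𝓜(ℂ, A)) : 𝓜(ℂ, A) :=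
  cfc Real.sqrt (1 - star z * z)

/-- `z` is a `z`-transform of the (unbounded) operator `T` on the Banach space `A`: it is a
multiplier of norm at most one and the graph of `T` is `{((1 - z* z)^{1/2} a, z a) : a ∈ A}`. -/
structure IsZTransform (T : A →ₗ.[ℂ] A) (z : 𝓜(ℂ, A)) : Prop where
  norm_le_one : ‖z‖ ≤ 1
  mem_graph_iff : ∀ x y : A,
    (x, y) ∈ T.graph ↔ ∃ a : A, x = (defect z).fst a ∧ y = z.fst a

/-- `T` is affiliated with `A` in the sense of Woronowicz: it is a densely defined operator on `A`
that has a `z`-transform in the multiplier algebra of `A`. -/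
structure IsAffiliated (T : A →ₗ.[ℂ] A) : Prop where
  dense_domain : Dense (T.domain : Set A)
  exists_zTransform : ∃ z : 𝓜(ℂ, A), IsZTransform T z

open scoped Classical in
/-- The `z`-transform `z(T)` of an affiliated operator `T` (and `0` by convention for an operator
that has none); it is unique by `IsZTransform.unique`. -/
noncomputable def zTransform (T : A →ₗ.[ℂ] A) : 𝓜(ℂ, A) :=
  if h : ∃ z : 𝓜(ℂ, A), IsZTransform T z then h.choose else 0

/-- The set of all `(x, y)` with `x* (T a) = y* a` for every `a` in the domain of `T`. -/
def adjointGraph (T : A →ₗ.[ℂ] A) : Submodule ℂ (A × A) where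
  carrier := {v | ∀ a : T.domain, star v.1 * T a = star v.2 * (a : A)}
  add_mem' := by
    intro v w hv hw a
    simp only [Prod.fst_add, Prod.snd_add, star_add, add_mul, hv a, hw a]
  zero_mem' := by
    intro a
    simp
  smul_mem' := by
    intro c v hv a
    simp only [Prod.smul_fst, Prod.smul_snd, star_smul, smul_mul_assoc, hv a]

/-- The adjoint `T*` of a densely defined operator `T` on `A`, where `A` is regarded as a Hilbert
module over itself with inner product `⟨x, y⟩ = x* y`. -/
noncomputable def adjoint (T : A →ₗ.[ℂ] A) : A →ₗ.[ℂ] A :=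
  (adjointGraph T).toLinearPMap

/-- The composition `X ∘ Y` on its natural domain `{a ∈ D(Y) : Y a ∈ D(X)}`. -/
def comp (X Y : A →ₗ.[ℂ] A) : A →ₗ.[ℂ] A :=
  X.comp (Y.domRestrict ((X.domain.comap Y.toFun).map Y.domain.subtype)) (by
    rintro ⟨x, hx, hx'⟩
    obtain ⟨y, hy, rfl⟩ := hx
    exact hy)

/-- The product `XY`, the closure of the composition `X ∘ Y` (used when `X ∘ Y` is closable). -/
noncomputable def prod (X Y : A →ₗ.[ℂ] A) : A →ₗ.[ℂ] A :=
  (comp X Y).closure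

/-- `T` is normal: `T* T = T T*`, as unbounded operators with their natural domains. -/
def IsNormal (T : A →ₗ.[ℂ] A) : Prop :=
  comp (adjoint T) T = comp T (adjoint T)

/-- `(R, S)` is a `(p², q²)`-commuting pair of normal elements affiliated with `A`. -/
structure IsCommutingPair (p q : ℝ) (R S : A →ₗ.[ℂ] A) : Prop where
  affiliated_left : IsAffiliated R
  affiliated_right : IsAffiliated S
  normal_left : IsNormal R
  normal_right : IsNormal S
  rel_adjoint : zTransform R * zTransform (adjoint S) =
    zTransform (((p * q : ℝ) : ℂ) • adjoint S) * zTransform (((q / p : ℝ) : ℂ) • R)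
  rel : zTransform (((q / p : ℝ) : ℂ) • R) * zTransform S =
    zTransform (((p * q : ℝ) : ℂ) • S) * zTransform R

/-! Facts showing that the definitions above mean what they should. -/

theorem mem_comp_graph (X Y : A →ₗ.[ℂ] A) (a c : A) :
    (a, c) ∈ (comp X Y).graph ↔ ∃ b, (a, b) ∈ Y.graph ∧ (b, c) ∈ X.graph := by
  simp only [LinearPMap.mem_graph_iff]
  constructor
  · rintro ⟨⟨x, hx, hx'⟩, rfl, rfl⟩
    obtain ⟨y, hy, rfl⟩ := hx
    exact ⟨Y y, ⟨y, rfl, rfl⟩, ⟨Y y, hy⟩, rfl, rfl⟩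
  · rintro ⟨b, ⟨y, rfl, rfl⟩, ⟨w, hw, rfl⟩⟩
    have hy : Y y ∈ X.domain := hw ▸ w.2
    refine ⟨⟨y, ⟨y, hy, rfl⟩, y.2⟩, rfl, ?_⟩
    exact congrArg X (Subtype.ext hw.symm)

theorem mem_adjoint_graph {T : A →ₗ.[ℂ] A} (hT : Dense (T.domain : Set A)) (x y : A) :
    (x, y) ∈ (adjoint T).graph ↔ ∀ a : T.domain, star x * T a = star y * (a : A) := by
  have h : (adjoint T).graph = adjointGraph T := by
    apply Submodule.toLinearPMap_graph_eq
    rintro ⟨u, v⟩ huv (rfl : u = 0)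
    have h0 : ∀ a ∈ (T.domain : Set A), star v * a = 0 := fun a ha => by
      simpa using (huv ⟨a, ha⟩).symm
    have h1 : (fun a : A => star v * a) = fun _ => 0 :=
      Continuous.ext_on hT (by fun_prop) continuous_const h0
    exact (CStarRing.star_mul_self_eq_zero_iff v).1 (congrFun h1 v)
  rw [h]
  rfl

theorem ext_fst {u v : 𝓜(ℂ, A)} (h : ∀ a, u.fst a = v.fst a) : u = v := by
  have hf : u.fst = v.fst := ContinuousLinearMap.ext h
  have hs : u.snd = v.snd := by
    ext x
    have h1 : ∀ y, (u.snd x - v.snd x) * y = 0 := fun y => by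
      rw [sub_mul, u.central, v.central, h, sub_self]
    have h2 := h1 (star (u.snd x - v.snd x))
    exact sub_eq_zero.1 ((CStarRing.mul_star_self_eq_zero_iff _).1 h2)
  exact DoubleCentralizer.ext _ _ _ _ (Prod.ext hf hs)

theorem isSelfAdjoint_defect (z : 𝓜(ℂ, A)) : IsSelfAdjoint (defect z) :=
  cfc_predicate _ _

theorem defect_mul_self {z : 𝓜(ℂ, A)} (hz : ‖z‖ ≤ 1) :
    defect z * defect z = 1 - star z * z := by
  have hsa : IsSelfAdjoint (1 - star z * z) := (IsSelfAdjoint.one _).sub (.star_mul_self z)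
  have hpos : ∀ x ∈ spectrum ℝ (1 - star z * z), 0 ≤ x := by
    intro x hx
    rw [show (1 : 𝓜(ℂ, A)) = algebraMap ℝ _ 1 by simp, ← spectrum.singleton_sub_eq] at hx
    obtain ⟨_, rfl, y, hy, rfl⟩ := hx
    have h1 : ‖y‖ ≤ ‖star z * z‖ * ‖(1 : 𝓜(ℂ, A))‖ := spectrum.norm_le_norm_mul_of_mem hy
    have h2 : ‖star z * z‖ = ‖z‖ * ‖z‖ := CStarRing.norm_star_mul_self
    have h3 : ‖(1 : 𝓜(ℂ, A))‖ ≤ 1 := by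
      rcases subsingleton_or_nontrivial (𝓜(ℂ, A)) with h | h
      · simp [Subsingleton.elim (1 : 𝓜(ℂ, A)) 0]
      · exact CStarRing.norm_one.le
    have h4 : ‖z‖ * ‖z‖ ≤ 1 := mul_le_one₀ hz (norm_nonneg _) hz
    have h5 : ‖y‖ ≤ 1 := h1.trans (by rw [h2]; exact mul_le_one₀ h4 (norm_nonneg _) h3)
    have h6 := le_abs_self y
    rw [Real.norm_eq_abs] at h5
    simp only
    linarith
  rw [defect, ← cfc_mul Real.sqrt Real.sqrt _ (by fun_prop) (by fun_prop)]
  conv_rhs => rw [← cfc_id ℝ (1 - star z * z) hsa]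
  exact cfc_congr fun x hx => Real.mul_self_sqrt (hpos x hx)

theorem IsZTransform.unique {T : A →ₗ.[ℂ] A} (hT : Dense (T.domain : Set A)) {z w : 𝓜(ℂ, A)}
    (hz : IsZTransform T z) (hw : IsZTransform T w) : z = w := by
  have key : ∀ {z w : 𝓜(ℂ, A)}, IsZTransform T z → IsZTransform T w →
      defect w * (defect w * defect z + star w * z) = defect z ∧
      w * (defect w * defect z + star w * z) = z := by
    intro z w hz hw
    have h : ∀ a, ∃ b, (defect w * defect z + star w * z).fst a = b ∧
        (defect z).fst a = (defect w).fst b ∧ z.fst a = w.fst b := by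
      intro a
      obtain ⟨b, h1, h2⟩ := (hw.mem_graph_iff _ _).1 ((hz.mem_graph_iff _ _).2 ⟨a, rfl, rfl⟩)
      refine ⟨b, ?_, h1, h2⟩
      have h3 : (defect w * defect w + star w * w).fst b = b := by
        rw [defect_mul_self hw.norm_le_one, sub_add_cancel]
        rfl
      conv_rhs => rw [← h3]
      change (defect w).fst ((defect z).fst a) + (star w).fst (z.fst a) = _
      rw [h1, h2]
      rfl
    constructor <;> refine ext_fst fun a => ?_ <;> obtain ⟨b, h1, h2, h3⟩ := h a
    · rw [h2, ← h1]; rfl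
    · rw [h3, ← h1]; rfl
  obtain ⟨h1, h2⟩ := key hz hw
  obtain ⟨h3, -⟩ := key hw hz
  have h4 : (defect w * defect z + star w * z) * defect z = defect w := by
    have := congrArg star h3
    simpa [(isSelfAdjoint_defect z).star_eq, (isSelfAdjoint_defect w).star_eq] using this
  have h5 : defect z * defect z = defect w * defect w := by
    calc defect z * defect z
        = defect w * (defect w * defect z + star w * z) * defect z := by rw [h1]
      _ = defect w * defect w := by rw [mul_assoc, h4]
  have h6 : defect z = defect w := by
    rw [defect_mul_self hz.norm_le_one, defect_mul_self hw.norm_le_one] at h5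
    rw [defect, defect, h5]
  have h7 : z * defect z = w * defect z := by
    calc z * defect z = w * (defect w * defect z + star w * z) * defect z := by rw [h2]
      _ = w * defect z := by rw [mul_assoc, h4, h6]
  have h8 : (fun x => z.fst x) = fun x => w.fst x := by
    refine Continuous.ext_on hT (by fun_prop) (by fun_prop) fun x hx => ?_
    obtain ⟨a, rfl, -⟩ := (hz.mem_graph_iff _ _).1 (T.mem_graph ⟨x, hx⟩)
    exact congrArg (fun m : 𝓜(ℂ, A) => m.fst a) h7
  exact ext_fst (congrFun h8)

theorem IsAffiliated.isZTransform {T : A →ₗ.[ℂ] A} (hT : IsAffiliated T) :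
    IsZTransform T (zTransform T) := by
  rw [zTransform, dif_pos hT.exists_zTransform]
  exact hT.exists_zTransform.choose_spec

end CStarAffiliated

namespace CStarAffiliated

/-! ### Intertwining relations, square roots and norm estimates in a unital C*-algebra. -/

section CStarAlgebra

variable {M : Type*} [CStarAlgebra M]

/-! Let `z`, `w` be the z-transforms of `R`, `S`, and put `t = z* z`, `u = w* w`, `s = q/p`, `r =
pq`, `n_a(x) = (1 + (a² - 1) x)^{-1/2}`. The transform of `sR` is `s z n_s(t)`, whose modulus
squared is `φ_s(t)` with `φ_s` the function `squareFun s`. Combining one defining relation with the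
adjoint of the other gives `w t = φ_s(t) w` and `z u = φ_r(u) z`. These pass to continuous
functions, so the defects `(1 - t)^{1/2}` and `(1 - u)^{1/2}` can be moved past `w`, `z` and their
adjoints at the price of an invertible factor `n_a`; moreover `t` and `u` commute.

Consequently the graph of `R ∘ S` contains all pairs `(X e, Y e)` with `Y = z w` and `X` a positive
multiplier of dense range, and it lies in the closed set `Y x = X' y`, where `Y X = X' Y`. The main
analytic step, `exists_zTransform_of_intertwine`, shows that the closure of the former is the latter
and is the graph of an operator with z-transform `Y (X² + Y* Y)^{-1/2}`. This handles all four
products (`comp_isClosable_and_isAffiliated`).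

The two asserted identities then compare implicit equations: multiplied by suitable invertible
`n_a(t)` and `n_r(u)`, the equations for `RS` and `SR` agree up to the scalar `r/s = p²`, those for
`RS*` and `S*R` up to `rs = q²` (`eq_smul_of_graph`). -/

/-- Clear for polynomials; Weierstrass approximation on an interval containing both spectra does the
rest. -/
theorem mul_cfc_of_mul_eq_mul {a b v : M} (ha : IsSelfAdjoint a) (hb : IsSelfAdjoint b)
    (h : v * a = b * v) {l u : ℝ} (hla : spectrum ℝ a ⊆ Set.Icc l u)
    (hlb : spectrum ℝ b ⊆ Set.Icc l u) {f : ℝ → ℝ} (hf : ContinuousOn f (Set.Icc l u)) :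
    v * cfc f a = cfc f b * v := by
  have hpow : ∀ n : ℕ, v * a ^ n = b ^ n * v := fun n =>
    (SemiconjBy.pow_right (show SemiconjBy v a b from h) n)
  have hpoly : ∀ P : Polynomial ℝ, v * Polynomial.aeval a P = Polynomial.aeval b P * v := by
    intro P
    induction P using Polynomial.induction_on' with
    | add P Q hP hQ => simp only [map_add, mul_add, add_mul, hP, hQ]
    | monomial n c =>
      simp only [Polynomial.aeval_monomial, ← Algebra.smul_def, mul_smul_comm, smul_mul_assoc,
        hpow]
  refine sub_eq_zero.1 (norm_le_zero_iff.1 (le_of_forall_pos_le_add fun ε hε => ?_))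
  rw [zero_add]
  -- There are two error terms, each at most `‖v‖ δ`; the `+ 1` keeps the denominator positive.
  set δ := ε / (2 * (‖v‖ + 1)) with hδ
  have hv : 0 < 2 * (‖v‖ + 1) := by positivity
  have hδ0 : 0 < δ := div_pos hε hv
  obtain ⟨P, hP⟩ := exists_polynomial_near_of_continuousOn l u f hf δ hδ0
  have key : ∀ c : M, IsSelfAdjoint c → spectrum ℝ c ⊆ Set.Icc l u →
      ‖cfc f c - Polynomial.aeval c P‖ ≤ δ := by
    intro c hc hs
    rw [← cfc_polynomial P c hc, ← cfc_sub f P.eval c (hf.mono hs) P.continuous.continuousOn]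
    refine norm_cfc_le hδ0.le fun x hx => ?_
    rw [Real.norm_eq_abs, abs_sub_comm]
    exact (hP x (hs hx)).le
  have h1 : v * cfc f a - cfc f b * v = v * (cfc f a - Polynomial.aeval a P) -
      (cfc f b - Polynomial.aeval b P) * v := by
    rw [mul_sub, sub_mul, hpoly]; abel
  calc ‖v * cfc f a - cfc f b * v‖ ≤ ‖v‖ * δ + δ * ‖v‖ := by
        rw [h1]
        refine (norm_sub_le _ _).trans (add_le_add ?_ ?_)
        · exact (norm_mul_le _ _).trans (mul_le_mul_of_nonneg_left (key a ha hla) (norm_nonneg _))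
        · exact (norm_mul_le _ _).trans (mul_le_mul_of_nonneg_right (key b hb hlb) (norm_nonneg _))
    _ ≤ δ * (2 * (‖v‖ + 1)) := by nlinarith
    _ = ε := by rw [hδ]; field_simp

theorem mul_cfc_of_mul_eq_mul_of_continuous {a b v : M} (ha : IsSelfAdjoint a)
    (hb : IsSelfAdjoint b) (h : v * a = b * v) {f : ℝ → ℝ} (hf : Continuous f) :
    v * cfc f a = cfc f b * v := by
  obtain ⟨r, hr⟩ := ((spectrum.isCompact (𝕜 := ℝ) a).union
    (spectrum.isCompact (𝕜 := ℝ) b)).isBounded.subset_closedBall 0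
  rw [Real.closedBall_eq_Icc] at hr
  exact mul_cfc_of_mul_eq_mul ha hb h (Set.subset_union_left.trans hr)
    (Set.subset_union_right.trans hr) hf.continuousOn

variable [PartialOrder M] [StarOrderedRing M]

theorem cfc_sqrt_nonneg (a : M) : 0 ≤ cfc Real.sqrt a :=
  cfc_nonneg fun _ _ => Real.sqrt_nonneg _

theorem cfc_sqrt_mul_self {a : M} (ha : 0 ≤ a) : cfc Real.sqrt a * cfc Real.sqrt a = a := by
  rw [← cfc_mul Real.sqrt Real.sqrt a (by fun_prop) (by fun_prop)]
  conv_rhs => rw [← cfc_id ℝ a ha.isSelfAdjoint]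
  exact cfc_congr fun x hx => Real.mul_self_sqrt (spectrum_nonneg_of_nonneg ha hx)

theorem cfc_sqrt_unique {a b : M} (hb : 0 ≤ b) (h : b * b = a) : cfc Real.sqrt a = b := by
  have hb' := hb.isSelfAdjoint
  have : a = cfc (fun x : ℝ => x * x) b := by
    rw [cfc_mul (fun x : ℝ => x) (fun x : ℝ => x) b, cfc_id' ℝ b, h]
  rw [this, ← cfc_comp' Real.sqrt (fun x : ℝ => x * x) b]
  conv_rhs => rw [← cfc_id ℝ b hb']
  exact cfc_congr fun x hx => Real.sqrt_mul_self (spectrum_nonneg_of_nonneg hb hx)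

theorem mul_cfc_sqrt_of_sq {a b v : M} (ha : 0 ≤ a) (hb : 0 ≤ b) (h : v * (a * a) = b * b * v) :
    v * a = b * v := by
  have := mul_cfc_of_mul_eq_mul_of_continuous (ha.isSelfAdjoint.mul_self_nonneg.isSelfAdjoint)
    (hb.isSelfAdjoint.mul_self_nonneg.isSelfAdjoint) h Real.continuous_sqrt
  rwa [cfc_sqrt_unique ha rfl, cfc_sqrt_unique hb rfl] at this

theorem norm_mul_le_norm_mul_of_sq_le {x y : M} (h : star x * x ≤ star y * y) (a : M) :
    ‖x * a‖ ≤ ‖y * a‖ := by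
  have h1 : star (x * a) * (x * a) ≤ star (y * a) * (y * a) := by
    simpa only [star_mul, mul_assoc] using star_left_conjugate_le_conjugate h a
  have h2 := CStarAlgebra.norm_le_norm_of_nonneg_of_le (star_mul_self_nonneg (x * a)) h1
  rw [CStarRing.norm_star_mul_self, CStarRing.norm_star_mul_self] at h2
  exact (mul_self_le_mul_self_iff (norm_nonneg _) (norm_nonneg _)).2 h2

/-- If `x² ≤ q²` with `q ≥ 0`, then `x` is in the closure of the right ideal generated by `q`. -/
theorem exists_norm_sub_mul_le {x q : M} (hx : IsSelfAdjoint x) (hq : 0 ≤ q)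
    (h : x * x ≤ q * q) {ε : ℝ} (hε : 0 < ε) : ∃ k : M, ‖x - q * k‖ ≤ ε := by
  have hqs := hq.isSelfAdjoint
  have hpos : ∀ y ∈ spectrum ℝ q, 0 < y + ε := fun y hy =>
    add_pos_of_nonneg_of_pos (spectrum_nonneg_of_nonneg hq hy) hε
  have hc1 : ContinuousOn (fun y : ℝ => ε / (y + ε)) (spectrum ℝ q) :=
    continuousOn_const.div (by fun_prop) fun y hy => (hpos y hy).ne'
  have hc2 : ContinuousOn (fun y : ℝ => 1 / (y + ε)) (spectrum ℝ q) :=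
    continuousOn_const.div (by fun_prop) fun y hy => (hpos y hy).ne'
  -- With `k₀ = (q + ε)⁻¹`, the error of approximating `x` by `q k₀ x` is `g x`, where `g = ε (q +
  -- ε)⁻¹`. Its adjoint `x g` is dominated in norm by `q g`, which has norm at most `ε`.
  set g := cfc (fun y : ℝ => ε / (y + ε)) q with hg
  set k := cfc (fun y : ℝ => 1 / (y + ε)) q with hk
  have h1 : g = 1 - q * k := by
    conv_rhs => rw [← cfc_id' ℝ q hqs]
    rw [hg, hk, cfc_id' ℝ q hqs]
    rw [← cfc_one ℝ q hqs]
    conv_rhs => enter [2, 1]; rw [← cfc_id' ℝ q hqs]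
    rw [← cfc_mul (fun y : ℝ => y) _ q (by fun_prop) hc2,
      ← cfc_sub _ _ q (by fun_prop) (by fun_prop)]
    refine cfc_congr fun y hy => ?_
    have := (hpos y hy).ne'
    simp only [Pi.one_apply]
    field_simp
    ring
  have hgs : IsSelfAdjoint g := cfc_predicate _ _
  have h2 : ‖q * g‖ ≤ ε := by
    have : q * g = cfc (fun y : ℝ => y * (ε / (y + ε))) q := by
      rw [cfc_mul (fun y : ℝ => y) _ q (by fun_prop) hc1, cfc_id' ℝ q hqs]
    rw [this]
    refine norm_cfc_le hε.le fun y hy => ?_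
    have hy0 := spectrum_nonneg_of_nonneg hq hy
    have := hpos y hy
    rw [Real.norm_of_nonneg (by positivity), mul_div_assoc', div_le_iff₀ this]
    nlinarith
  refine ⟨k * x, ?_⟩
  have h3 : x - q * (k * x) = star (x * g) := by
    rw [star_mul, hx.star_eq, hgs.star_eq, h1, sub_mul, one_mul, mul_assoc]
  rw [h3, norm_star]
  refine (norm_mul_le_norm_mul_of_sq_le (y := q) ?_ g).trans h2
  rwa [hx.star_eq, hqs.star_eq]

end CStarAlgebra

/-! ### Functional calculus for the passage from `T` to `sT`. -/

section Scaling

/-- The function `t ↦ (1 + (s² - 1) t)^{-1/2}`. -/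
noncomputable def scaleFun (s x : ℝ) : ℝ := (Real.sqrt (1 + (s ^ 2 - 1) * x))⁻¹

/-- The function relating `|z(sT)|²` to `|z(T)|²`. -/
noncomputable def squareFun (s x : ℝ) : ℝ := s ^ 2 * x / (1 + (s ^ 2 - 1) * x)

theorem one_add_mul_pos {s x : ℝ} (hs : 0 < s) (hx : x ∈ Set.Icc (0 : ℝ) 1) :
    0 < 1 + (s ^ 2 - 1) * x := by
  have h : 0 < s ^ 2 := by positivity
  rcases hx.2.lt_or_eq with h1 | rfl
  · nlinarith [mul_nonneg h.le hx.1]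
  · linarith

theorem continuousOn_scaleFun {s : ℝ} (hs : 0 < s) :
    ContinuousOn (scaleFun s) (Set.Icc (0 : ℝ) 1) :=
  ContinuousOn.inv₀ (by fun_prop) fun _ hx => (Real.sqrt_pos.2 (one_add_mul_pos hs hx)).ne'

theorem continuousOn_squareFun {s : ℝ} (hs : 0 < s) :
    ContinuousOn (squareFun s) (Set.Icc (0 : ℝ) 1) :=
  ContinuousOn.div (by fun_prop) (by fun_prop) fun _ hx => (one_add_mul_pos hs hx).ne'

theorem scaleFun_pos {s x : ℝ} (hs : 0 < s) (hx : x ∈ Set.Icc (0 : ℝ) 1) : 0 < scaleFun s x :=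
  inv_pos.2 (Real.sqrt_pos.2 (one_add_mul_pos hs hx))

theorem scaleFun_mul_self {s x : ℝ} (hs : 0 < s) (hx : x ∈ Set.Icc (0 : ℝ) 1) :
    scaleFun s x * scaleFun s x = (1 + (s ^ 2 - 1) * x)⁻¹ := by
  rw [scaleFun, ← mul_inv, Real.mul_self_sqrt (one_add_mul_pos hs hx).le]

theorem one_sub_squareFun {s x : ℝ} (hs : 0 < s) (hx : x ∈ Set.Icc (0 : ℝ) 1) :
    1 - squareFun s x = (1 - x) * (scaleFun s x * scaleFun s x) := by
  rw [scaleFun_mul_self hs hx, squareFun]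
  have := (one_add_mul_pos hs hx).ne'
  rw [← div_eq_mul_inv, eq_div_iff this, sub_mul, div_mul_cancel₀ _ this]
  ring

theorem squareFun_mem {s x : ℝ} (hs : 0 < s) (hx : x ∈ Set.Icc (0 : ℝ) 1) :
    squareFun s x ∈ Set.Icc (0 : ℝ) 1 := by
  constructor
  · exact div_nonneg (mul_nonneg (by positivity) hx.1) (one_add_mul_pos hs hx).le
  · have := one_sub_squareFun hs hx
    have h2 := mul_nonneg (sub_nonneg.2 hx.2) (mul_self_nonneg (scaleFun s x))
    linarith

theorem sqrt_one_sub_squareFun {s x : ℝ} (hs : 0 < s) (hx : x ∈ Set.Icc (0 : ℝ) 1) :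
    Real.sqrt (1 - squareFun s x) = Real.sqrt (1 - x) * scaleFun s x := by
  rw [one_sub_squareFun hs hx, Real.sqrt_mul (sub_nonneg.2 hx.2),
    Real.sqrt_mul_self (scaleFun_pos hs hx).le]

theorem scaleFun_mul_scaleFun_inv {s x : ℝ} (hs : 0 < s) (hx : x ∈ Set.Icc (0 : ℝ) 1) :
    scaleFun s x * scaleFun s⁻¹ (squareFun s x) = 1 := by
  have h0 := one_add_mul_pos hs hx
  have h : 1 + (s⁻¹ ^ 2 - 1) * squareFun s x = (1 + (s ^ 2 - 1) * x)⁻¹ := by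
    rw [squareFun]
    refine eq_inv_of_mul_eq_one_left ?_
    rw [add_mul, mul_assoc, div_mul_cancel₀ _ h0.ne']
    field_simp
    ring
  rw [scaleFun, scaleFun, h, Real.sqrt_inv, inv_inv]
  exact inv_mul_cancel₀ (Real.sqrt_pos.2 h0).ne'

variable {M : Type*} [CStarAlgebra M] {t v : M} {s : ℝ}

/-- The scaling multiplier `(1 + (s² - 1) t)^{-1/2}`. -/
noncomputable def scale (s : ℝ) (t : M) : M := cfc (scaleFun s) t

/-- The element `(1 - t)^{1/2}`. -/
noncomputable def coRoot (t : M) : M := cfc (fun x => Real.sqrt (1 - x)) t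

/-- A self-adjoint element with spectrum in the unit interval. -/
structure IsUnitInterval (t : M) : Prop where
  isSelfAdjoint : IsSelfAdjoint t
  spectrum_subset : spectrum ℝ t ⊆ Set.Icc 0 1

theorem isSelfAdjoint_scale : IsSelfAdjoint (scale s t) := cfc_predicate _ _

theorem IsUnitInterval.isUnit_scale (ht : IsUnitInterval t) (hs : 0 < s) : IsUnit (scale s t) :=
  (isUnit_cfc_iff _ _ ((continuousOn_scaleFun hs).mono ht.spectrum_subset) ht.isSelfAdjoint).2
    fun _ hx => (scaleFun_pos hs (ht.spectrum_subset hx)).ne'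

theorem cfc_sqrt_one_sub (ht : IsSelfAdjoint t) : cfc Real.sqrt (1 - t) = coRoot t := by
  have : 1 - t = cfc (fun x : ℝ => 1 - x) t := by
    rw [cfc_sub (fun _ => (1 : ℝ)) (fun x => x) t, cfc_const_one ℝ t, cfc_id' ℝ t]
  rw [this, ← cfc_comp' Real.sqrt (fun x : ℝ => 1 - x) t, coRoot]

theorem IsUnitInterval.coRoot_mul_scale (ht : IsUnitInterval t) (hs : 0 < s) :
    coRoot t * scale s t = cfc (fun x => Real.sqrt (1 - squareFun s x)) t := by
  rw [coRoot, scale, ← cfc_mul _ _ t (by fun_prop)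
    ((continuousOn_scaleFun hs).mono ht.spectrum_subset)]
  exact cfc_congr fun x hx => (sqrt_one_sub_squareFun hs (ht.spectrum_subset hx)).symm

theorem IsUnitInterval.cfc_squareFun_eq (ht : IsUnitInterval t) (hs : 0 < s) :
    cfc (squareFun s) t = s ^ 2 • (scale s t * t * scale s t) := by
  have hc := (continuousOn_scaleFun hs).mono ht.spectrum_subset
  have h1 : scale s t * t * scale s t =
      cfc (fun x => scaleFun s x * x * scaleFun s x) t := by
    rw [cfc_mul (fun x => scaleFun s x * x) _ t (hc.mul continuousOn_id) hc,
      cfc_mul _ (fun x => x) t hc continuousOn_id, cfc_id' ℝ t ht.isSelfAdjoint, scale]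
  rw [h1, ← cfc_smul _ (fun x => scaleFun s x * x * scaleFun s x) t
    ((hc.mul continuousOn_id).mul hc)]
  refine cfc_congr fun x hx => ?_
  have hx' := ht.spectrum_subset hx
  simp only [smul_eq_mul]
  rw [mul_right_comm, scaleFun_mul_self hs hx', squareFun]
  ring

theorem IsUnitInterval.cfc_squareFun (ht : IsUnitInterval t) (hs : 0 < s) :
    IsUnitInterval (cfc (squareFun s) t) := by
  refine ⟨cfc_predicate _ _, ?_⟩
  rw [cfc_map_spectrum (R := ℝ) (squareFun s) t ht.isSelfAdjoint
    ((continuousOn_squareFun hs).mono ht.spectrum_subset)]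
  rintro _ ⟨x, hx, rfl⟩
  exact squareFun_mem hs (ht.spectrum_subset hx)

theorem IsUnitInterval.coRoot_squareFun (ht : IsUnitInterval t) (hs : 0 < s) :
    coRoot (cfc (squareFun s) t) = coRoot t * scale s t := by
  rw [ht.coRoot_mul_scale hs, coRoot, ← cfc_comp' (fun x => Real.sqrt (1 - x)) (squareFun s) t
    (by fun_prop) ((continuousOn_squareFun hs).mono ht.spectrum_subset) ht.isSelfAdjoint]

/-- The hypothesis intertwines `t` with `φ_s(t)`, and `φ_s` preserves the unit interval, so `f` may
be applied on both sides. -/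
theorem IsUnitInterval.mul_cfc (ht : IsUnitInterval t) (hs : 0 < s)
    (h : v * t = cfc (squareFun s) t * v) {f : ℝ → ℝ} (hf : ContinuousOn f (Set.Icc 0 1)) :
    v * cfc f t = cfc (fun x => f (squareFun s x)) t * v := by
  have ht' := ht.cfc_squareFun hs
  rw [mul_cfc_of_mul_eq_mul ht.isSelfAdjoint ht'.isSelfAdjoint h ht.spectrum_subset
    ht'.spectrum_subset hf]
  rw [← cfc_comp' f (squareFun s) t (hf.mono ?_)
    ((continuousOn_squareFun hs).mono ht.spectrum_subset) ht.isSelfAdjoint]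
  rintro _ ⟨x, hx, rfl⟩
  exact squareFun_mem hs (ht.spectrum_subset hx)

theorem IsUnitInterval.mul_coRoot (ht : IsUnitInterval t) (hs : 0 < s)
    (h : v * t = cfc (squareFun s) t * v) :
    v * coRoot t = coRoot t * scale s t * v := by
  rw [ht.coRoot_mul_scale hs, coRoot, ht.mul_cfc hs h (by fun_prop)]

/-- Moving `n_{1/s}(t)` to the left of `v` turns it into `n_{1/s}(φ_s(t))`, the inverse of `n_s(t)`:
scaling by `1/s` undoes scaling by `s`. -/
theorem IsUnitInterval.scale_mul_mul_scale_inv (ht : IsUnitInterval t) (hs : 0 < s)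
    (h : v * t = cfc (squareFun s) t * v) :
    scale s t * v * scale s⁻¹ t = v := by
  have hs' := inv_pos.2 hs
  rw [mul_assoc]
  conv_lhs => enter [2]; rw [scale, ht.mul_cfc hs h (continuousOn_scaleFun hs')]
  rw [scale, ← mul_assoc, ← cfc_mul _ (fun x => scaleFun s⁻¹ (squareFun s x)) t
    ((continuousOn_scaleFun hs).mono ht.spectrum_subset)
    (((continuousOn_scaleFun hs').comp (continuousOn_squareFun hs)
      fun x hx => squareFun_mem hs hx).mono ht.spectrum_subset)]
  rw [cfc_congr (g := fun _ => (1 : ℝ)) fun x hx =>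
    scaleFun_mul_scaleFun_inv hs (ht.spectrum_subset hx), cfc_const_one ℝ t ht.isSelfAdjoint,
    one_mul]

theorem coRoot_commute_scale : Commute (coRoot t) (scale s t) := cfc_commute_cfc _ _ _

theorem IsUnitInterval.coRoot_mul (ht : IsUnitInterval t) (hs : 0 < s)
    (h : v * t = cfc (squareFun s) t * v) :
    coRoot t * v = v * (coRoot t * scale s⁻¹ t) := by
  rw [← mul_assoc, ht.mul_coRoot hs h]
  conv_lhs => rw [← ht.scale_mul_mul_scale_inv hs h]
  simp only [mul_assoc]

section Order

variable [PartialOrder M] [StarOrderedRing M]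

theorem coRoot_nonneg : 0 ≤ coRoot t := cfc_nonneg fun _ _ => Real.sqrt_nonneg _

theorem IsUnitInterval.scale_nonneg (ht : IsUnitInterval t) (hs : 0 < s) : 0 ≤ scale s t :=
  cfc_nonneg fun _ hx => (scaleFun_pos hs (ht.spectrum_subset hx)).le

theorem isUnitInterval_of_nonneg_of_le (h0 : 0 ≤ t) (h1 : t ≤ 1) : IsUnitInterval t := by
  refine ⟨h0.isSelfAdjoint, fun x hx => ⟨spectrum_nonneg_of_nonneg h0 hx, ?_⟩⟩
  exact (le_algebraMap_iff_spectrum_le (r := (1 : ℝ)) (a := t) (ha := h0.isSelfAdjoint)).1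
    (by simpa using h1) x hx

end Order

end Scaling

/-! ### Multipliers with dense range, and division by them. -/

section Multiplier

variable {A : Type*} [NonUnitalCStarAlgebra A]

/-- The order on the multiplier algebra given by the positive elements. -/
@[reducible]
noncomputable def multiplierOrder : PartialOrder 𝓜(ℂ, A) := CStarAlgebra.spectralOrder _

attribute [local instance] multiplierOrder

theorem multiplierStarOrderedRing : StarOrderedRing 𝓜(ℂ, A) := CStarAlgebra.spectralOrderedRing _

attribute [local instance] multiplierStarOrderedRing

theorem mul_fst_apply (u v : 𝓜(ℂ, A)) (a : A) : (u * v).fst a = u.fst (v.fst a) := rfl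

theorem fst_apply_congr {u v : 𝓜(ℂ, A)} (h : u = v) (a : A) : u.fst a = v.fst a := by rw [h]

theorem star_fst_mul (u : 𝓜(ℂ, A)) (a b : A) : star (u.fst a) * b = star a * (star u).fst b := by
  have := u.central (star b) a
  rw [DoubleCentralizer.star_fst, ← star_star b, ← star_mul, ← this, star_mul, star_star]

theorem fst_mul (u : 𝓜(ℂ, A)) (a b : A) : u.fst (a * b) = u.fst a * b := by
  have h : ∀ x, x * u.fst (a * b) = x * (u.fst a * b) := fun x => by
    rw [← u.central, ← mul_assoc, u.central, mul_assoc]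
  have h2 := h (star (u.fst (a * b) - u.fst a * b))
  rw [← sub_eq_zero, ← mul_sub, CStarRing.star_mul_self_eq_zero_iff] at h2
  exact sub_eq_zero.1 h2

/-- `A` embeds isometrically in its multiplier algebra, and there `w a` is an honest product, so the
C*-algebraic estimate applies. -/
theorem norm_fst_le_norm_fst {u v : 𝓜(ℂ, A)} (h : star u * u ≤ star v * v) (a : A) :
    ‖u.fst a‖ ≤ ‖v.fst a‖ := by
  have hn : ∀ a : A, ‖(a : 𝓜(ℂ, A))‖ = ‖a‖ := fun a => by
    rw [← DoubleCentralizer.norm_fst, DoubleCentralizer.coe_fst,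
      ContinuousLinearMap.opNorm_mul_apply]
  have hc : ∀ (w : 𝓜(ℂ, A)) (a : A), w * (a : 𝓜(ℂ, A)) = (w.fst a : A) := fun w a =>
    ext_fst fun b => by
      rw [mul_fst_apply, DoubleCentralizer.coe_fst, DoubleCentralizer.coe_fst]
      exact fst_mul w a b
  have := norm_mul_le_norm_mul_of_sq_le h (a : 𝓜(ℂ, A))
  rwa [hc, hc, hn, hn] at this

theorem eq_of_mul_right_denseRange {u v w : 𝓜(ℂ, A)} (hw : DenseRange w.fst)
    (h : u * w = v * w) : u = v := by
  refine ext_fst fun a => congrFun (hw.equalizer (by fun_prop) (by fun_prop) ?_) a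
  exact funext fun b => fst_apply_congr h b

theorem fst_injective_of_denseRange {w : 𝓜(ℂ, A)} (hw : DenseRange (star w).fst) :
    Function.Injective w.fst := by
  refine (injective_iff_map_eq_zero _).2 fun y hy => ?_
  have h : (fun a : A => star y * a) = fun _ => 0 := by
    refine hw.equalizer (by fun_prop) (by fun_prop) (funext fun b => ?_)
    simp only [Function.comp_apply]
    rw [← star_fst_mul, hy, star_zero, zero_mul]
  exact (CStarRing.star_mul_self_eq_zero_iff y).1 (congrFun h y)

theorem eq_of_mul_left_denseRange {u v w : 𝓜(ℂ, A)} (hw : DenseRange (star w).fst)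
    (h : w * u = w * v) : u = v :=
  ext_fst fun a => fst_injective_of_denseRange hw (fst_apply_congr h a)

theorem denseRange_mul {u v : 𝓜(ℂ, A)} (hu : DenseRange u.fst) (hv : DenseRange v.fst) :
    DenseRange (u * v).fst :=
  hu.comp hv u.fst.continuous

theorem denseRange_of_isUnit {u : 𝓜(ℂ, A)} (hu : IsUnit u) : DenseRange u.fst := by
  obtain ⟨v, hv⟩ := hu.exists_right_inv
  have h : Function.Surjective u.fst := fun a => ⟨v.fst a, fst_apply_congr hv a⟩
  exact h.denseRange

/-- `x` is a norm limit of multipliers `q k`, so every `x a` is a limit of points in the range of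
`q`. -/
theorem denseRange_of_sq_le {x q : 𝓜(ℂ, A)} (hx : IsSelfAdjoint x) (hq : 0 ≤ q)
    (h : x * x ≤ q * q) (hd : DenseRange x.fst) : DenseRange q.fst := by
  refine dense_closure.1 (hd.mono ?_)
  rintro _ ⟨a, rfl⟩
  refine Metric.mem_closure_range_iff.2 fun ε hε => ?_
  have ha : 0 < ‖a‖ + 1 := by positivity
  obtain ⟨k, hk⟩ := exists_norm_sub_mul_le hx hq h (div_pos hε ha)
  refine ⟨k.fst a, ?_⟩
  rw [dist_eq_norm]
  calc ‖x.fst a - q.fst (k.fst a)‖ = ‖(x - q * k).fst a‖ := rfl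
    _ ≤ ε / (‖a‖ + 1) * ‖a‖ := by
      refine ((x - q * k).fst.le_opNorm a).trans ?_
      rw [DoubleCentralizer.norm_fst]
      exact mul_le_mul_of_nonneg_right hk (norm_nonneg _)
    _ < ε / (‖a‖ + 1) * (‖a‖ + 1) := by
      have := div_pos hε ha
      nlinarith
    _ = ε := div_mul_cancel₀ _ ha.ne'

/-- Division of multipliers: `Y` factors as `ζ Q = Q' ζ`. -/
theorem exists_mul_eq {Y Q Q' : 𝓜(ℂ, A)} (hQ : IsSelfAdjoint Q) (hQ' : IsSelfAdjoint Q')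
    (dQ : DenseRange Q.fst) (dQ' : DenseRange Q'.fst) (h : Y * Q = Q' * Y)
    (h1 : star Y * Y ≤ Q * Q) (h2 : Y * star Y ≤ Q' * Q') :
    ∃ ζ : 𝓜(ℂ, A), ζ * Q = Y ∧ Q' * ζ = Y := by
  have n1 : ∀ a, ‖Y.fst a‖ ≤ 1 * ‖Q.fst a‖ := fun a => by
    rw [one_mul]
    exact norm_fst_le_norm_fst (by rwa [hQ.star_eq]) a
  have n2 : ∀ a, ‖(star Y).fst a‖ ≤ 1 * ‖Q'.fst a‖ := fun a => by
    rw [one_mul]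
    exact norm_fst_le_norm_fst (by rwa [hQ'.star_eq, star_star]) a
  -- The left action of `ζ` extends `Q a ↦ Y a`; the adjoint's action extends `Q' a ↦ Y* a`. Both
  -- are contractive by the operator inequalities.
  let f : A →L[ℂ] A := (Y.fst : A →ₗ[ℂ] A).extendOfNorm (Q.fst : A →ₗ[ℂ] A)
  let g : A →L[ℂ] A := ((star Y).fst : A →ₗ[ℂ] A).extendOfNorm (Q'.fst : A →ₗ[ℂ] A)
  have hf : ∀ a, f (Q.fst a) = Y.fst a :=
    LinearMap.extendOfNorm_eq (e := (Q.fst : A →ₗ[ℂ] A)) dQ ⟨1, n1⟩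
  have hg : ∀ a, g (Q'.fst a) = (star Y).fst a :=
    LinearMap.extendOfNorm_eq (e := (Q'.fst : A →ₗ[ℂ] A)) dQ' ⟨1, n2⟩
  have adj : ∀ x y, star (f x) * y = star x * g y := by
    intro x y
    -- By density it suffices to test on `x = Q a`, `y = Q' b`, where the identity is the adjoint of
    -- `Y Q = Q' Y`.
    have key : (fun p : A × A => star (f p.1) * p.2) = fun p => star p.1 * g p.2 := by
      refine (dQ.prodMap dQ').equalizer (by fun_prop) (by fun_prop) (funext fun p => ?_)
      simp only [Function.comp_apply, Prod.map_fst, Prod.map_snd, hf, hg]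
      rw [star_fst_mul, star_fst_mul, hQ.star_eq, ← mul_fst_apply, ← mul_fst_apply]
      have h3 := congrArg star h
      rw [star_mul, star_mul, hQ.star_eq, hQ'.star_eq] at h3
      rw [h3]
    exact congrFun key (x, y)
  let ζ : 𝓜(ℂ, A) :=
    { fst := f
      snd := (((starₗᵢ ℂ : A ≃ₗᵢ⋆[ℂ] A) : A →L⋆[ℂ] A).comp g).comp
          ((starₗᵢ ℂ : A ≃ₗᵢ⋆[ℂ] A) : A →L⋆[ℂ] A)
      central := fun x y => by
        have := congrArg star (adj y (star x))
        simpa using this.symm }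
  have e1 : ζ * Q = Y := ext_fst hf
  refine ⟨ζ, e1, eq_of_mul_right_denseRange dQ ?_⟩
  rw [mul_assoc, e1, h]

end Multiplier

/-! ### Implicit equations of graphs, and the construction of z-transforms. -/

section Graph

variable {A : Type*} [NonUnitalCStarAlgebra A]

attribute [local instance] multiplierOrder

attribute [local instance] multiplierStarOrderedRing

theorem star_mul_self_le_one {z : 𝓜(ℂ, A)} (hz : ‖z‖ ≤ 1) : star z * z ≤ 1 := by
  have h : ‖star z * z‖ ≤ 1 := by
    rw [CStarRing.norm_star_mul_self]
    exact mul_le_one₀ hz (norm_nonneg _) hz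
  exact CStarAlgebra.norm_le_one_iff_of_nonneg _ (star_mul_self_nonneg z) |>.1 h

theorem norm_le_one_of_star_mul_self_le {z : 𝓜(ℂ, A)} (hz : star z * z ≤ 1) : ‖z‖ ≤ 1 := by
  have h := (CStarAlgebra.norm_le_one_iff_of_nonneg _ (star_mul_self_nonneg z)).2 hz
  rw [CStarRing.norm_star_mul_self] at h
  nlinarith [norm_nonneg z]

theorem isUnitInterval_star_mul_self {z : 𝓜(ℂ, A)} (hz : ‖z‖ ≤ 1) : IsUnitInterval (star z * z) :=
  isUnitInterval_of_nonneg_of_le (star_mul_self_nonneg z) (star_mul_self_le_one hz)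

theorem defect_eq_coRoot (z : 𝓜(ℂ, A)) : defect z = coRoot (star z * z) :=
  cfc_sqrt_one_sub (.star_mul_self z)

theorem defect_nonneg (z : 𝓜(ℂ, A)) : 0 ≤ defect z := cfc_sqrt_nonneg _

theorem mul_defect (z : 𝓜(ℂ, A)) : z * defect z = defect (star z) * z := by
  refine mul_cfc_of_mul_eq_mul_of_continuous ?_ ?_ ?_ Real.continuous_sqrt
  · exact (IsSelfAdjoint.one _).sub (.star_mul_self z)
  · exact (IsSelfAdjoint.one _).sub (.star_mul_self (star z))
  · rw [star_star, mul_sub, sub_mul, mul_one, one_mul, mul_assoc]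

/-- The graph of the operator with `z`-transform `z` in implicit form. -/
theorem exists_defect_iff {z : 𝓜(ℂ, A)} (hz : ‖z‖ ≤ 1) (x y : A) :
    (∃ a, x = (defect z).fst a ∧ y = z.fst a) ↔ z.fst x = (defect (star z)).fst y := by
  have h1 := mul_defect z
  have h2 := mul_defect (star z)
  rw [star_star] at h2
  have h3 := defect_mul_self hz
  have h4 := defect_mul_self (z := star z) (by rwa [norm_star])
  rw [star_star] at h4
  constructor
  · rintro ⟨a, rfl, rfl⟩
    exact fst_apply_congr h1 a
  · intro h
    -- Since the squared defect plus `z* z` is `1`, a point `(defect z a, z a)` determines `a` by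
    -- this formula.
    refine ⟨(defect z).fst x + (star z).fst y, ?_, ?_⟩
    · rw [map_add, ← mul_fst_apply, ← mul_fst_apply, h3, ← h2, mul_fst_apply (star z), ← h,
        ← mul_fst_apply (star z)]
      exact (fst_apply_congr (sub_add_cancel 1 (star z * z)) x).symm
    · rw [map_add, ← mul_fst_apply, ← mul_fst_apply, h1, mul_fst_apply (defect (star z)), h,
        ← mul_fst_apply (defect (star z)), h4]
      exact (fst_apply_congr (sub_add_cancel 1 (z * star z)) y).symm

/-- Identifies the quotient `d = X Q⁻¹` as a positive square root without proving directly that `d ≥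
0`: `e` commutes with `Q`, so `e Q` and `X` are positive with the same square, and `Q` cancels. -/
theorem eq_of_mul_eq_of_mul_self_eq {X Q d e : 𝓜(ℂ, A)} (hX : 0 ≤ X) (hQ : 0 ≤ Q)
    (dQ : DenseRange Q.fst) (h1 : d * Q = X) (h2 : Q * d = X) (he : 0 ≤ e) (h : e * e = d * d) :
    e = d := by
  have heQ : Commute Q e := by
    refine mul_cfc_sqrt_of_sq he he ?_
    rw [h, ← mul_assoc, h2, mul_assoc d, h1, ← h1, mul_assoc, h2, h1]
  have h0 : 0 ≤ e * Q := Commute.mul_nonneg he hQ heQ.symm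
  refine eq_of_mul_right_denseRange dQ ?_
  have h3 : e * Q * (e * Q) = X * X := by
    rw [← mul_assoc, mul_assoc e, heQ.eq, ← mul_assoc, h, mul_assoc d, h1]
    rw [show d * X = X * d by rw [← h1, mul_assoc, h2, h1], mul_assoc, h1]
  rw [h1, ← cfc_sqrt_unique hX rfl, ← h3, cfc_sqrt_unique h0 rfl]

/-- If `Y X = X' Y` with positive multipliers `X` and `X'` of dense range, then the closure of
`{(X e, Y e)}` is the graph of an operator that has a `z`-transform, and it is given by the equation
`Y x = X' y`. -/
theorem exists_zTransform_of_intertwine {X X' Y : 𝓜(ℂ, A)} (hX : 0 ≤ X) (hX' : 0 ≤ X')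
    (dX : DenseRange X.fst) (dX' : DenseRange X'.fst) (h : Y * X = X' * Y) :
    ∃ ζ : 𝓜(ℂ, A), ‖ζ‖ ≤ 1 ∧
      (∀ x y, Y.fst x = X'.fst y ↔ ∃ a, x = (defect ζ).fst a ∧ y = ζ.fst a) ∧
      ∀ x y, Y.fst x = X'.fst y →
        (x, y) ∈ closure (Set.range fun e => (X.fst e, Y.fst e)) := by
  have sX := hX.isSelfAdjoint
  have sX' := hX'.isSelfAdjoint
  have h' : X * star Y = star Y * X' := by
    have := congrArg star h
    rwa [star_mul, star_mul, sX.star_eq, sX'.star_eq] at this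
  -- With `Q = P^{1/2}` and `Q' = P'^{1/2}`, the z-transform will be `ζ = Y Q⁻¹ = Q'⁻¹ Y`, with
  -- defects `X Q⁻¹` and `X' Q'⁻¹`.
  obtain ⟨P, hP⟩ : ∃ P, P = X * X + star Y * Y := ⟨_, rfl⟩
  obtain ⟨P', hP'⟩ : ∃ P', P' = X' * X' + Y * star Y := ⟨_, rfl⟩
  have hX2 : X * X ≤ P := hP ▸ le_add_of_nonneg_right (star_mul_self_nonneg Y)
  have hX2' : X' * X' ≤ P' := hP' ▸ le_add_of_nonneg_right (mul_star_self_nonneg Y)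
  have hY2 : star Y * Y ≤ P := hP ▸ le_add_of_nonneg_left sX.mul_self_nonneg
  have hY2' : Y * star Y ≤ P' := hP' ▸ le_add_of_nonneg_left sX'.mul_self_nonneg
  have P0 : 0 ≤ P := (star_mul_self_nonneg Y).trans hY2
  have P0' : 0 ≤ P' := (mul_star_self_nonneg Y).trans hY2'
  obtain ⟨Q, hQ⟩ : ∃ Q, Q = cfc Real.sqrt P := ⟨_, rfl⟩
  obtain ⟨Q', hQ'⟩ : ∃ Q', Q' = cfc Real.sqrt P' := ⟨_, rfl⟩
  have Q0 : 0 ≤ Q := hQ ▸ cfc_sqrt_nonneg _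
  have Q0' : 0 ≤ Q' := hQ' ▸ cfc_sqrt_nonneg _
  have sQ := Q0.isSelfAdjoint
  have sQ' := Q0'.isSelfAdjoint
  have QQ : Q * Q = P := hQ ▸ cfc_sqrt_mul_self P0
  have QQ' : Q' * Q' = P' := hQ' ▸ cfc_sqrt_mul_self P0'
  rw [← QQ] at hX2 hY2
  rw [← QQ'] at hX2' hY2'
  have dQ := denseRange_of_sq_le sX Q0 hX2 dX
  have dQ' := denseRange_of_sq_le sX' Q0' hX2' dX'
  have YQ : Y * Q = Q' * Y := by
    rw [hQ, hQ']
    refine mul_cfc_of_mul_eq_mul_of_continuous P0.isSelfAdjoint P0'.isSelfAdjoint ?_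
      Real.continuous_sqrt
    rw [hP, hP', mul_add, add_mul, ← mul_assoc, h, mul_assoc, h]
    simp only [mul_assoc]
  have XQ : X * Q = Q * X := by
    rw [hQ]
    refine mul_cfc_of_mul_eq_mul_of_continuous P0.isSelfAdjoint P0.isSelfAdjoint ?_
      Real.continuous_sqrt
    rw [hP, mul_add, add_mul, ← mul_assoc X (star Y), h', mul_assoc (star Y), ← h]
    simp only [mul_assoc]
  have XQ' : X' * Q' = Q' * X' := by
    rw [hQ']
    refine mul_cfc_of_mul_eq_mul_of_continuous P0'.isSelfAdjoint P0'.isSelfAdjoint ?_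
      Real.continuous_sqrt
    rw [hP', mul_add, add_mul, ← mul_assoc X' Y, ← h, mul_assoc Y, h']
    simp only [mul_assoc]
  obtain ⟨ζ, ζ1, ζ2⟩ := exists_mul_eq sQ sQ' dQ dQ' YQ hY2 hY2'
  obtain ⟨d, d1, d2⟩ := exists_mul_eq sQ sQ dQ dQ XQ (by rwa [sX.star_eq]) (by rwa [sX.star_eq])
  obtain ⟨d', e1, e2⟩ := exists_mul_eq sQ' sQ' dQ' dQ' XQ' (by rwa [sX'.star_eq])
    (by rwa [sX'.star_eq])
  have dQs : DenseRange (star Q).fst := by rwa [sQ.star_eq]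
  have dQs' : DenseRange (star Q').fst := by rwa [sQ'.star_eq]
  have s1 : Q * star ζ = star Y := by rw [← ζ1, star_mul, sQ.star_eq]
  have s2 : star ζ * Q' = star Y := by rw [← ζ2, star_mul, sQ'.star_eq]
  have dd : d * d = 1 - star ζ * ζ := by
    -- Sandwiched between two factors `Q`, the claim becomes `X² = P - Y* Y`.
    refine eq_of_mul_right_denseRange dQ (eq_of_mul_left_denseRange dQs ?_)
    rw [sub_mul, mul_sub, one_mul, QQ, hP, mul_assoc, d1, ← mul_assoc, d2, mul_assoc, ζ1,
      ← mul_assoc, s1, add_sub_cancel_right]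
  have dd' : d' * d' = 1 - star (star ζ) * star ζ := by
    refine eq_of_mul_right_denseRange dQ' (eq_of_mul_left_denseRange dQs' ?_)
    rw [star_star, sub_mul, mul_sub, one_mul, QQ', hP', mul_assoc, e1, ← mul_assoc, e2, mul_assoc,
      s2, ← mul_assoc, ζ2, add_sub_cancel_right]
  have ζn : ‖ζ‖ ≤ 1 := by
    refine norm_le_one_of_star_mul_self_le ?_
    rw [← sub_nonneg, ← dd]
    have sd : star d = d := by
      refine eq_of_mul_left_denseRange dQs ?_
      rw [d2, ← sX.star_eq, ← d1, star_mul, sQ.star_eq]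
    exact IsSelfAdjoint.mul_self_nonneg sd
  have D1 : defect ζ = d := by
    refine eq_of_mul_eq_of_mul_self_eq hX Q0 dQ d1 d2 (defect_nonneg ζ) ?_
    rw [dd, defect_mul_self ζn]
  have D2 : defect (star ζ) = d' := by
    refine eq_of_mul_eq_of_mul_self_eq hX' Q0' dQ' e1 e2 (defect_nonneg _) ?_
    rw [dd', defect_mul_self (by rwa [norm_star])]
  have iff : ∀ x y, Y.fst x = X'.fst y ↔ ∃ a, x = (defect ζ).fst a ∧ y = ζ.fst a := by
    intro x y
    rw [exists_defect_iff ζn, D2, ← ζ2, ← e2, mul_fst_apply, mul_fst_apply]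
    exact (fst_injective_of_denseRange dQs').eq_iff
  refine ⟨ζ, ζn, iff, fun x y hxy => ?_⟩
  obtain ⟨a, rfl, rfl⟩ := (iff x y).1 hxy
  rw [D1]
  have hc : Continuous fun a => (d.fst a, ζ.fst a) := by fun_prop
  -- The range of `Q` is dense, and `a = Q e` gives exactly the pair `(X e, Y e)`.
  refine map_mem_closure (f := fun a => (d.fst a, ζ.fst a)) hc (dQ a) ?_
  rintro _ ⟨e, rfl⟩
  exact ⟨e, Prod.ext (fst_apply_congr d1 e).symm (fst_apply_congr ζ1 e).symm⟩

end Graph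

/-! ### Adjoints and normality in terms of the z-transform. -/

section Operators

variable {A : Type*} [NonUnitalCStarAlgebra A] {T : A →ₗ.[ℂ] A} {z : 𝓜(ℂ, A)}

theorem mem_domain_iff_exists_graph (T : A →ₗ.[ℂ] A) (x : A) :
    x ∈ T.domain ↔ ∃ y, (x, y) ∈ T.graph := by
  rw [← LinearPMap.graph_map_fst_eq_domain]
  simp only [Submodule.mem_map, LinearMap.fst_apply, Prod.exists]
  exact ⟨fun ⟨a, b, h, e⟩ => ⟨b, e ▸ h⟩, fun ⟨y, h⟩ => ⟨x, y, h, rfl⟩⟩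

theorem IsZTransform.domain_eq (h : IsZTransform T z) :
    (T.domain : Set A) = Set.range (defect z).fst := by
  ext x
  rw [SetLike.mem_coe, mem_domain_iff_exists_graph]
  constructor
  · rintro ⟨y, hy⟩
    obtain ⟨a, rfl, -⟩ := (h.mem_graph_iff _ _).1 hy
    exact ⟨a, rfl⟩
  · rintro ⟨a, rfl⟩
    exact ⟨_, (h.mem_graph_iff _ _).2 ⟨a, rfl, rfl⟩⟩

theorem IsZTransform.dense_iff (h : IsZTransform T z) :
    Dense (T.domain : Set A) ↔ DenseRange (defect z).fst := by
  rw [h.domain_eq, DenseRange]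

theorem IsZTransform.zTransform_eq (h : IsZTransform T z) (hd : DenseRange (defect z).fst) :
    zTransform T = z := by
  have hT := h.dense_iff.2 hd
  exact IsZTransform.unique hT (IsAffiliated.isZTransform ⟨hT, z, h⟩) h

theorem IsZTransform.mem_adjoint_graph_iff (h : IsZTransform T z)
    (hd : DenseRange (defect z).fst) (x y : A) :
    (x, y) ∈ (adjoint T).graph ↔ (star z).fst x = (defect z).fst y := by
  rw [mem_adjoint_graph (h.dense_iff.2 hd)]
  have hs : ∀ a : A, star x * z.fst a = star ((star z).fst x) * a ∧
      star y * (defect z).fst a = star ((defect z).fst y) * a := fun a => by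
    rw [star_fst_mul, star_fst_mul, star_star, (isSelfAdjoint_defect z).star_eq]
    exact ⟨rfl, rfl⟩
  constructor
  · intro hxy
    have h1 : ∀ a, star ((star z).fst x - (defect z).fst y) * a = 0 := fun a => by
      obtain ⟨u, hu1, hu2⟩ := (LinearPMap.mem_graph_iff _).1
        ((h.mem_graph_iff _ _).2 ⟨a, rfl, rfl⟩)
      have := hxy u
      simp only at hu1 hu2
      rw [hu1, hu2, (hs a).1, (hs a).2] at this
      rw [star_sub, sub_mul, this, sub_self]
    exact sub_eq_zero.1 ((CStarRing.star_mul_self_eq_zero_iff _).1 (h1 _))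
  · intro hxy u
    obtain ⟨a, ha1, ha2⟩ := (h.mem_graph_iff _ _).1 (T.mem_graph u)
    rw [ha1, ha2, (hs a).1, (hs a).2, hxy]

theorem IsZTransform.adjoint (h : IsZTransform T z) (hd : DenseRange (defect z).fst) :
    IsZTransform (adjoint T) (star z) where
  norm_le_one := by rw [norm_star]; exact h.norm_le_one
  mem_graph_iff x y := by
    rw [h.mem_adjoint_graph_iff hd, exists_defect_iff (by rw [norm_star]; exact h.norm_le_one),
      star_star]

theorem IsZTransform.isStarNormal (h : IsZTransform T z) (hd : DenseRange (defect z).fst)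
    (hT : IsNormal T) : star z * z = z * star z := by
  have h1 := mul_defect z
  have h2 := mul_defect (star z)
  rw [star_star] at h2
  have hz := h.norm_le_one
  have h3 := defect_mul_self hz
  have h4 := defect_mul_self (z := star z) (by rwa [norm_star])
  rw [star_star] at h4
  -- Every `a` is `x + T*T x` with `x = (defect z)² a`. Normality gives `a = x + TT* x` as well,
  -- which forces `x = (defect z*)² a`.
  have key : defect (star z) * defect (star z) = defect z * defect z := by
    refine ext_fst fun a => ?_
    have ha : ((defect z * defect z).fst a, (star z * z).fst a) ∈
        (comp (CStarAffiliated.adjoint T) T).graph := by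
      refine (mem_comp_graph _ _ _ _).2 ⟨(z * defect z).fst a,
        (h.mem_graph_iff _ _).2 ⟨(defect z).fst a, rfl, rfl⟩,
        (h.mem_adjoint_graph_iff hd _ _).2 ?_⟩
      rw [← mul_fst_apply, ← mul_fst_apply, h1, ← mul_assoc, ← mul_assoc, h2]
    rw [hT] at ha
    obtain ⟨b, hb1, hb2⟩ := (mem_comp_graph _ _ _ _).1 ha
    obtain ⟨c, rfl, hc⟩ := (h.mem_graph_iff _ _).1 hb2
    rw [h.mem_adjoint_graph_iff hd] at hb1
    obtain ⟨x, hx⟩ : ∃ x, x = (defect z * defect z).fst a := ⟨_, rfl⟩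
    obtain ⟨y, hy⟩ : ∃ y, y = (star z * z).fst a := ⟨_, rfl⟩
    have hxy : a = x + y := by
      rw [hx, hy, h3]
      exact (fst_apply_congr (sub_add_cancel 1 (star z * z)) a).symm
    rw [← hx] at hb1
    rw [← hy] at hc
    have h5 : (defect (star z) * defect (star z)).fst y = (z * star z).fst x := by
      rw [hc, ← mul_fst_apply, mul_assoc, ← h1, ← mul_assoc, ← h1, mul_fst_apply, mul_fst_apply z,
        mul_fst_apply z, ← hb1]
    rw [← hx, hxy, map_add, h5, h4]
    change x - (z * star z).fst x + (z * star z).fst x = x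
    exact sub_add_cancel _ _
  rw [h3, h4, sub_right_inj] at key
  exact key.symm

end Operators

/-! ### Scaled operators and closures of compositions. -/

section Products

variable {A : Type*} [NonUnitalCStarAlgebra A]

attribute [local instance] multiplierOrder

attribute [local instance] multiplierStarOrderedRing

/-- The `z`-transform of `sT` in terms of the `z`-transform `z` of `T`. -/
noncomputable def scaled (s : ℝ) (z : 𝓜(ℂ, A)) : 𝓜(ℂ, A) :=
  (s : ℂ) • (z * scale s (star z * z))

theorem star_scaled_mul_scaled {z : 𝓜(ℂ, A)} (hz : ‖z‖ ≤ 1) {s : ℝ} (hs : 0 < s) :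
    star (scaled s z) * scaled s z = cfc (squareFun s) (star z * z) := by
  rw [(isUnitInterval_star_mul_self hz).cfc_squareFun_eq hs, scaled, star_smul, star_mul,
    isSelfAdjoint_scale.star_eq, smul_mul_smul_comm, Complex.star_def, Complex.conj_ofReal,
    ← Complex.ofReal_mul, ← sq, Complex.coe_smul]
  simp only [mul_assoc]

theorem defect_scaled {z : 𝓜(ℂ, A)} (hz : ‖z‖ ≤ 1) {s : ℝ} (hs : 0 < s) :
    defect (scaled s z) = defect z * scale s (star z * z) := by
  rw [defect_eq_coRoot, defect_eq_coRoot, star_scaled_mul_scaled hz hs,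
    (isUnitInterval_star_mul_self hz).coRoot_squareFun hs]

theorem norm_scaled_le {z : 𝓜(ℂ, A)} (hz : ‖z‖ ≤ 1) {s : ℝ} (hs : 0 < s) : ‖scaled s z‖ ≤ 1 := by
  refine norm_le_one_of_star_mul_self_le ?_
  have ht := isUnitInterval_star_mul_self hz
  rw [star_scaled_mul_scaled hz hs]
  exact cfc_le_one _ _ fun x hx => (squareFun_mem hs (ht.spectrum_subset hx)).2

theorem denseRange_defect_scaled {z : 𝓜(ℂ, A)} (hz : ‖z‖ ≤ 1) (hd : DenseRange (defect z).fst)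
    {s : ℝ} (hs : 0 < s) : DenseRange (defect (scaled s z)).fst := by
  rw [defect_scaled hz hs]
  exact denseRange_mul hd
    (denseRange_of_isUnit ((isUnitInterval_star_mul_self hz).isUnit_scale hs))

theorem mem_smul_graph_iff (T : A →ₗ.[ℂ] A) (c : ℂ) (x y : A) :
    (x, y) ∈ (c • T).graph ↔ ∃ y', (x, y') ∈ T.graph ∧ y = c • y' := by
  rw [LinearPMap.smul_graph]
  simp only [Submodule.mem_map, Prod.exists, LinearMap.prodMap_apply, LinearMap.id_apply,
    LinearMap.smul_apply, Prod.mk.injEq]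
  exact ⟨fun ⟨a, b, h, e1, e2⟩ => ⟨b, e1 ▸ h, e2.symm⟩, fun ⟨y', h, e⟩ => ⟨x, y', h, rfl, e.symm⟩⟩

theorem IsZTransform.smul {T : A →ₗ.[ℂ] A} {z : 𝓜(ℂ, A)} (h : IsZTransform T z) {s : ℝ}
    (hs : 0 < s) : IsZTransform ((s : ℂ) • T) (scaled s z) where
  norm_le_one := norm_scaled_le h.norm_le_one hs
  mem_graph_iff x y := by
    rw [mem_smul_graph_iff, defect_scaled h.norm_le_one hs]
    obtain ⟨N, hN⟩ :=
      ((isUnitInterval_star_mul_self h.norm_le_one).isUnit_scale hs).exists_right_inv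
    constructor
    · rintro ⟨y', hy, rfl⟩
      obtain ⟨a, rfl, rfl⟩ := (h.mem_graph_iff _ _).1 hy
      have ha : (scale s (star z * z)).fst (N.fst a) = a := fst_apply_congr hN a
      refine ⟨N.fst a, ?_, ?_⟩
      · rw [mul_fst_apply, ha]
      · change _ = (s : ℂ) • z.fst ((scale s (star z * z)).fst (N.fst a))
        rw [ha]
    · rintro ⟨a, rfl, rfl⟩
      exact ⟨z.fst ((scale s (star z * z)).fst a), (h.mem_graph_iff _ _).2 ⟨_, rfl, rfl⟩, rfl⟩

/-- The composition of two normal affiliated operators whose `z`-transforms intertwine. -/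
theorem comp_isClosable_and_isAffiliated {T₁ T₂ : A →ₗ.[ℂ] A} {z₁ z₂ E F : 𝓜(ℂ, A)}
    (h₁ : IsZTransform T₁ z₁) (h₂ : IsZTransform T₂ z₂)
    (n₁ : star z₁ * z₁ = z₁ * star z₁) (n₂ : star z₂ * z₂ = z₂ * star z₂)
    (d₁ : DenseRange (defect z₁).fst) (d₂ : DenseRange (defect z₂).fst)
    (hE : 0 ≤ E) (hF : 0 ≤ F) (dE : DenseRange E.fst) (dF : DenseRange F.fst)
    (cE : Commute (defect z₂) E) (cF : Commute F (defect z₁))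
    (e₁ : defect z₁ * z₂ = z₂ * E) (e₂ : z₁ * defect z₂ = F * z₁) :
    ((comp T₁ T₂).IsClosable ∧ IsAffiliated (prod T₁ T₂)) ∧
      ∀ x y, (x, y) ∈ (prod T₁ T₂).graph ↔ (z₁ * z₂).fst x = (F * defect z₁).fst y := by
  have c₁ : z₁ * defect z₁ = defect z₁ * z₁ := by
    rw [mul_defect, defect, defect, star_star, n₁]
  have c₂ : z₂ * defect z₂ = defect z₂ * z₂ := by
    rw [mul_defect, defect, defect, star_star, n₂]
  have hYX : z₁ * z₂ * (defect z₂ * E) = F * defect z₁ * (z₁ * z₂) := by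
    calc z₁ * z₂ * (defect z₂ * E) = z₁ * (z₂ * defect z₂) * E := by simp only [mul_assoc]
      _ = z₁ * defect z₂ * (z₂ * E) := by rw [c₂]; simp only [mul_assoc]
      _ = F * (z₁ * defect z₁) * z₂ := by rw [e₂, ← e₁]; simp only [mul_assoc]
      _ = F * defect z₁ * (z₁ * z₂) := by rw [c₁]; simp only [mul_assoc]
  have hX : 0 ≤ defect z₂ * E := Commute.mul_nonneg (defect_nonneg _) hE cE
  have hX' : 0 ≤ F * defect z₁ := Commute.mul_nonneg hF (defect_nonneg _) cF
  have dX := denseRange_mul d₂ dE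
  have dX' := denseRange_mul dF d₁
  obtain ⟨ζ, ζn, hζ, hcl⟩ := exists_zTransform_of_intertwine hX hX' dX dX' hYX
  have hinj : Function.Injective (F * defect z₁).fst :=
    fst_injective_of_denseRange (by rwa [hX'.isSelfAdjoint.star_eq])
  -- The candidate closure, cut out by `Y x = X' y` with `Y = z₁ z₂` and `X' = F (defect z₁)`.
  let G : Submodule ℂ (A × A) :=
    LinearMap.eqLocus (((z₁ * z₂).fst : A →ₗ[ℂ] A) ∘ₗ LinearMap.fst ℂ A A)
      (((F * defect z₁).fst : A →ₗ[ℂ] A) ∘ₗ LinearMap.snd ℂ A A)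
  have hG : ∀ x y, (x, y) ∈ G ↔ (z₁ * z₂).fst x = (F * defect z₁).fst y := fun x y => Iff.rfl
  have hGgraph : G.toLinearPMap.graph = G := by
    refine Submodule.toLinearPMap_graph_eq G ?_
    rintro ⟨x, y⟩ hxy (rfl : x = 0)
    rw [hG, map_zero] at hxy
    exact hinj (by rw [← hxy, map_zero])
  have hle : (comp T₁ T₂).graph ≤ G := by
    rintro ⟨x, y⟩ hxy
    obtain ⟨b, hb₂, hb₁⟩ := (mem_comp_graph _ _ _ _).1 hxy
    obtain ⟨a, rfl, rfl⟩ := (h₂.mem_graph_iff _ _).1 hb₂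
    obtain ⟨c, hc, rfl⟩ := (h₁.mem_graph_iff _ _).1 hb₁
    rw [hG]
    calc (z₁ * z₂).fst ((defect z₂).fst a) = (z₁ * (z₂ * defect z₂)).fst a := rfl
      _ = (F * z₁).fst (z₂.fst a) := by rw [c₂, ← mul_assoc, e₂]; rfl
      _ = (F * (z₁ * defect z₁)).fst c := by rw [hc]; rfl
      _ = _ := by rw [c₁]; rfl
  have hGclosed : IsClosed (G : Set (A × A)) := by
    refine isClosed_eq (f := fun p : A × A => (z₁ * z₂).fst p.1)
      (g := fun p : A × A => (F * defect z₁).fst p.2) (by fun_prop) (by fun_prop)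
  -- `T₂` sends this first coordinate to `z₂ E e = defect z₁ (z₂ e)`, which lies in the domain of
  -- `T₁`.
  have hcore : ∀ e, ((defect z₂ * E).fst e, (z₁ * z₂).fst e) ∈ (comp T₁ T₂).graph := by
    intro e
    refine (mem_comp_graph _ _ _ _).2 ⟨z₂.fst (E.fst e),
      (h₂.mem_graph_iff _ _).2 ⟨E.fst e, rfl, rfl⟩, (h₁.mem_graph_iff _ _).2 ⟨z₂.fst e, ?_, rfl⟩⟩
    exact (fst_apply_congr e₁ e).symm
  have hclosure : (comp T₁ T₂).graph.topologicalClosure = G := by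
    refine le_antisymm (Submodule.topologicalClosure_minimal _ hle hGclosed) ?_
    rintro ⟨x, y⟩ hxy
    refine closure_mono ?_ (hcl x y ((hG x y).1 hxy))
    rintro _ ⟨e, rfl⟩
    exact hcore e
  have hclosable : (comp T₁ T₂).IsClosable := ⟨G.toLinearPMap, by rw [hclosure, hGgraph]⟩
  have hgraph : (prod T₁ T₂).graph = G := by
    rw [prod, ← hclosable.graph_closure_eq_closure_graph, hclosure]
  have hz : IsZTransform (prod T₁ T₂) ζ := ⟨ζn, fun x y => by rw [hgraph, hG, hζ]⟩
  refine ⟨⟨hclosable, ⟨?_, ζ, hz⟩⟩, fun x y => by rw [hgraph, hG]⟩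
  refine dX.mono ?_
  rintro _ ⟨e, rfl⟩
  rw [SetLike.mem_coe, mem_domain_iff_exists_graph]
  exact ⟨_, by rw [hgraph]; exact hle (hcore e)⟩

end Products

/-! ### Consequences of the two commutation relations. -/

section CommutingPairs

variable {A : Type*} [NonUnitalCStarAlgebra A]

attribute [local instance] multiplierOrder

attribute [local instance] multiplierStarOrderedRing

theorem eq_smul_of_graph {T₁ T₂ : A →ₗ.[ℂ] A} {X₁ X₂ Y₁ Y₂ N K : 𝓜(ℂ, A)} {c : ℂ} (hc : c ≠ 0)
    (hN : IsUnit N) (hK : IsUnit K)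
    (h₁ : ∀ x y, (x, y) ∈ T₁.graph ↔ Y₁.fst x = X₁.fst y)
    (h₂ : ∀ x y, (x, y) ∈ T₂.graph ↔ Y₂.fst x = X₂.fst y)
    (hY : N * Y₁ = c • (K * Y₂)) (hX : N * X₁ = K * X₂) : T₁ = c • T₂ := by
  have inj : ∀ {u : 𝓜(ℂ, A)}, IsUnit u → Function.Injective u.fst := fun hu =>
    fst_injective_of_denseRange (denseRange_of_isUnit hu.star)
  refine LinearPMap.eq_of_eq_graph (Submodule.ext ?_)
  rintro ⟨x, y⟩
  have hY' : N.fst (Y₁.fst x) = K.fst (c • Y₂.fst x) := by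
    rw [map_smul]; exact fst_apply_congr hY x
  have hX' : N.fst (X₁.fst y) = K.fst (X₂.fst y) := fst_apply_congr hX y
  rw [mem_smul_graph_iff, h₁, ← (inj hN).eq_iff, hY', hX', (inj hK).eq_iff]
  constructor
  · intro h
    refine ⟨c⁻¹ • y, (h₂ _ _).2 ?_, (smul_inv_smul₀ hc y).symm⟩
    rw [map_smul, ← h, inv_smul_smul₀ hc]
  · rintro ⟨y', hy', rfl⟩
    rw [map_smul, (h₂ _ _).1 hy']

section Relations

variable {z w : 𝓜(ℂ, A)} {p q s : ℝ}

theorem defect_star_of_normal (hz : star z * z = z * star z) : defect (star z) = defect z := by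
  rw [defect, defect, star_star, hz]

theorem commute_scale_of_normal (hz : star z * z = z * star z) :
    Commute z (scale s (star z * z)) := by
  refine (Commute.cfc_real ?_ _).symm
  rw [Commute, SemiconjBy, hz, mul_assoc, ← hz]

theorem star_scaled (hz : star z * z = z * star z) : star (scaled s z) = scaled s (star z) := by
  have h := congrArg star (commute_scale_of_normal (s := s) hz).eq
  rw [star_mul, star_mul, isSelfAdjoint_scale.star_eq] at h
  rw [scaled, scaled, star_star, ← hz, star_smul, star_mul, isSelfAdjoint_scale.star_eq, h,
    Complex.star_def, Complex.conj_ofReal]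

/-- The adjoint of the first relation rewrites `w z*`, and the second then absorbs the remaining
`z`, leaving the modulus squared of `scaled s z`. -/
theorem mul_eq_squareFun_mul_left (hz1 : ‖z‖ ≤ 1) (hs : 0 < s) {r : ℝ}
    (hw : star w * w = w * star w)
    (rel_adjoint : z * star w = scaled r (star w) * scaled s z)
    (rel : scaled s z * w = scaled r w * z) :
    w * (star z * z) = cfc (squareFun s) (star z * z) * w := by
  rw [← star_scaled_mul_scaled hz1 hs]
  have h := congrArg star rel_adjoint
  rw [← star_scaled hw, star_mul, star_mul, star_star, star_star] at h
  rw [← mul_assoc, h, mul_assoc, ← rel, mul_assoc]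

theorem mul_eq_squareFun_mul_right (hw1 : ‖w‖ ≤ 1) {r : ℝ} (hr : 0 < r)
    (hw : star w * w = w * star w)
    (rel_adjoint : z * star w = scaled r (star w) * scaled s z)
    (rel : scaled s z * w = scaled r w * z) :
    z * (star w * w) = cfc (squareFun r) (star w * w) * z := by
  rw [← star_scaled_mul_scaled hw1 hr, ← mul_assoc, rel_adjoint, mul_assoc, rel, ← mul_assoc,
    star_scaled hw]

/-- Both products equal `z* b z`. Applied with `u = w* w`, this makes functions of the two moduli
commute. -/
theorem commute_of_mul_eq {b u : 𝓜(ℂ, A)} (hu : IsSelfAdjoint u) (hb : IsSelfAdjoint b)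
    (h : z * u = b * z) : Commute (star z * z) u := by
  have h' := congrArg star h
  rw [star_mul, star_mul, hu.star_eq, hb.star_eq] at h'
  rw [Commute, SemiconjBy, mul_assoc, h, ← mul_assoc, ← h', mul_assoc]

theorem nonneg_coRoot_mul_scale (hz : ‖z‖ ≤ 1) (hs : 0 < s) :
    0 ≤ defect z * scale s (star z * z) := by
  rw [defect_eq_coRoot]
  exact Commute.mul_nonneg coRoot_nonneg ((isUnitInterval_star_mul_self hz).scale_nonneg hs)
    coRoot_commute_scale

end Relations

theorem IsAffiliated.denseRange_defect {T : A →ₗ.[ℂ] A} (h : IsAffiliated T) :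
    DenseRange (defect (zTransform T)).fst :=
  h.isZTransform.dense_iff.1 h.dense_domain

end CommutingPairs
end CStarAffiliated

/-! ### The theorem. -/

section
open CStarAffiliated
attribute [local instance] multiplierOrder

attribute [local instance] multiplierStarOrderedRing

theorem mainTheorem4 {A : Type*} [NonUnitalCStarAlgebra A] (p q : ℝ) (hp : 0 < p) (hq : 0 < q)
    (R S : A →ₗ.[ℂ] A) (hRS : CStarAffiliated.IsCommutingPair p q R S) :
    ((CStarAffiliated.comp R S).IsClosable ∧
      CStarAffiliated.IsAffiliated (CStarAffiliated.prod R S)) ∧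
    ((CStarAffiliated.comp S R).IsClosable ∧
      CStarAffiliated.IsAffiliated (CStarAffiliated.prod S R)) ∧
    ((CStarAffiliated.comp R (CStarAffiliated.adjoint S)).IsClosable ∧
      CStarAffiliated.IsAffiliated (CStarAffiliated.prod R (CStarAffiliated.adjoint S))) ∧
    ((CStarAffiliated.comp (CStarAffiliated.adjoint S) R).IsClosable ∧
      CStarAffiliated.IsAffiliated (CStarAffiliated.prod (CStarAffiliated.adjoint S) R)) ∧
    CStarAffiliated.prod R S = ((p ^ 2 : ℝ) : ℂ) • CStarAffiliated.prod S R ∧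
    CStarAffiliated.prod R (CStarAffiliated.adjoint S) =
      ((q ^ 2 : ℝ) : ℂ) • CStarAffiliated.prod (CStarAffiliated.adjoint S) R := by
  obtain ⟨z, hz⟩ : ∃ z, z = zTransform R := ⟨_, rfl⟩
  obtain ⟨w, hw⟩ : ∃ w, w = zTransform S := ⟨_, rfl⟩
  have zR := hRS.affiliated_left.isZTransform
  have wS := hRS.affiliated_right.isZTransform
  have dz := hRS.affiliated_left.denseRange_defect
  have dw := hRS.affiliated_right.denseRange_defect
  rw [← hz] at zR dz
  rw [← hw] at wS dw
  have nz := zR.isStarNormal dz hRS.normal_left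
  have nw := wS.isStarNormal dw hRS.normal_right
  have z1 := zR.norm_le_one
  have w1 := wS.norm_le_one
  have wS' := wS.adjoint dw
  have w1' := wS'.norm_le_one
  have dw' : DenseRange (defect (star w)).fst := by rwa [defect_star_of_normal nw]
  have nw' : star (star w) * star w = star w * star (star w) := by rw [star_star, nw]
  obtain ⟨s, hs⟩ : ∃ s, s = q / p := ⟨_, rfl⟩
  obtain ⟨r, hr⟩ : ∃ r, r = p * q := ⟨_, rfl⟩
  have s0 : 0 < s := hs ▸ div_pos hq hp
  have r0 : 0 < r := hr ▸ mul_pos hp hq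
  have rel1 := hRS.rel_adjoint
  have rel2 := hRS.rel
  rw [← hs, ← hr, ← hz, wS'.zTransform_eq dw',
    (zR.smul s0).zTransform_eq (denseRange_defect_scaled z1 dz s0),
    (wS'.smul r0).zTransform_eq (denseRange_defect_scaled w1' dw' r0)] at rel1
  rw [← hs, ← hr, ← hz, ← hw,
    (zR.smul s0).zTransform_eq (denseRange_defect_scaled z1 dz s0),
    (wS.smul r0).zTransform_eq (denseRange_defect_scaled w1 dw r0)] at rel2
  -- From here on the relations between `z` and `w` enter through these two intertwinings, apart
  -- from the final comparison of scalars.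
  have hA := mul_eq_squareFun_mul_left z1 s0 nw rel1 rel2
  have hB := mul_eq_squareFun_mul_right w1 r0 nw rel1 rel2
  have It := isUnitInterval_star_mul_self z1
  have Iu := isUnitInterval_star_mul_self w1
  have s0' := inv_pos.2 s0
  have r0' := inv_pos.2 r0
  have ctu : Commute (star z * z) (star w * w) :=
    commute_of_mul_eq (.star_mul_self w) (cfc_predicate _ _) hB
  have cfg : ∀ f g : ℝ → ℝ, Commute (cfc f (star z * z)) (cfc g (star w * w)) := fun f g =>
    ((ctu.cfc_real f).symm.cfc_real g).symm
  have Dz := defect_eq_coRoot z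
  have Dw := defect_eq_coRoot w
  have Dw' := defect_star_of_normal nw
  have cDD : Commute (defect z) (defect w) := by rw [Dz, Dw]; exact cfg _ _
  have cDK : ∀ a, Commute (defect z) (scale a (star w * w)) := by rw [Dz]; exact fun a => cfg _ _
  have cND : ∀ a, Commute (scale a (star z * z)) (defect w) := by rw [Dw]; exact fun a => cfg _ _
  have cNK : ∀ a b, Commute (scale a (star z * z)) (scale b (star w * w)) := fun a b => cfg _ _
  have dE : ∀ a, 0 < a → DenseRange (defect z * scale a (star z * z)).fst := fun a ha =>
    denseRange_mul dz (denseRange_of_isUnit (It.isUnit_scale ha))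
  have dF : ∀ a, 0 < a → DenseRange (defect w * scale a (star w * w)).fst := fun a ha =>
    denseRange_mul dw (denseRange_of_isUnit (Iu.isUnit_scale ha))
  have cE : ∀ a, Commute (defect w) (defect z * scale a (star z * z)) := fun a =>
    cDD.symm.mul_right (cND a).symm
  have cF : ∀ a, Commute (defect w * scale a (star w * w)) (defect z) := fun a =>
    (cDD.mul_right (cDK a)).symm
  have i1 := It.coRoot_mul s0 hA
  have i2 := It.mul_coRoot s0 hA
  have i3 := Iu.coRoot_mul r0 hB
  have i4 := Iu.mul_coRoot r0 hB
  have i5 := It.scale_mul_mul_scale_inv s0 hA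
  rw [← Dz] at i1 i2
  rw [← Dw] at i3 i4
  have cDN : ∀ a, Commute (defect z) (scale a (star z * z)) := fun a => by
    rw [Dz]; exact coRoot_commute_scale
  have sa {a : ℝ} {t : 𝓜(ℂ, A)} : star (scale a t) = scale a t := isSelfAdjoint_scale.star_eq
  have i1' : star w * defect z = defect z * scale s⁻¹ (star z * z) * star w := by
    have := congrArg star i1
    rwa [star_mul, star_mul, star_mul, sa, (isSelfAdjoint_defect z).star_eq, ← (cDN _).eq] at this
  have i2' : defect z * star w = star w * (defect z * scale s (star z * z)) := by
    have := congrArg star i2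
    rwa [star_mul, star_mul, star_mul, sa, (isSelfAdjoint_defect z).star_eq, ← (cDN _).eq] at this
  have i5' : scale s⁻¹ (star z * z) * star w * scale s (star z * z) = star w := by
    have := congrArg star i5
    rwa [star_mul, star_mul, sa, sa, ← mul_assoc] at this
  -- For each product, `E` and `F` are what the inner and outer transforms turn the other operator's
  -- defect into; the index `s`, `s⁻¹`, `r` or `r⁻¹` records the direction of the move.
  obtain ⟨a1, g1⟩ := comp_isClosable_and_isAffiliated zR wS nz nw dz dw
    (nonneg_coRoot_mul_scale z1 s0') (nonneg_coRoot_mul_scale w1 r0) (dE _ s0') (dF _ r0)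
    (cE _) (cF _) i1 i4
  obtain ⟨a2, g2⟩ := comp_isClosable_and_isAffiliated wS zR nw nz dw dz
    (nonneg_coRoot_mul_scale w1 r0') (nonneg_coRoot_mul_scale z1 s0) (dF _ r0') (dE _ s0)
    (cF _).symm (cE _).symm i3 i2
  obtain ⟨a3, g3⟩ := comp_isClosable_and_isAffiliated zR wS' nz nw' dz dw'
    (nonneg_coRoot_mul_scale z1 s0) (nonneg_coRoot_mul_scale w1 r0) (dE _ s0) (dF _ r0)
    (by rw [Dw']; exact cE _) (cF _) i2' (by rw [Dw']; exact i4)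
  obtain ⟨a4, g4⟩ := comp_isClosable_and_isAffiliated wS' zR nw' nz dw' dz
    (nonneg_coRoot_mul_scale w1 r0') (nonneg_coRoot_mul_scale z1 s0') (dF _ r0') (dE _ s0')
    (cF _).symm (by rw [Dw']; exact (cE _).symm) (by rw [Dw']; exact i3) i1'
  -- All four factors are functions of `t` or of `u`, hence commute. The value `a = s` serves `RS`,
  -- and `a = s⁻¹` serves `RS*`.
  have hX : ∀ a, scale a (star z * z) * (defect w * scale r (star w * w) * defect z) =
      scale r (star w * w) * (defect z * scale a (star z * z) * defect w) := fun a => by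
    have c1 : Commute (scale a (star z * z)) (defect w * scale r (star w * w)) :=
      (cND a).mul_right (cNK a r)
    have c2 : Commute (defect w) (scale r (star w * w)) := by rw [Dw]; exact coRoot_commute_scale
    have c3 := cE a
    rw [← mul_assoc, c1.eq, mul_assoc, ← (cDN a).eq, c2.eq, mul_assoc, c3.eq]
  have cz := (commute_scale_of_normal (s := s) nz).eq
  have cw := (commute_scale_of_normal (s := r) nw).eq
  have cw' : star w * scale r (star w * w) = scale r (star w * w) * star w := by
    have := congrArg star cw
    rw [star_mul, star_mul, sa] at this
    exact this.symm
  refine ⟨a1, a2, a3, a4, ?_, ?_⟩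
  · refine eq_smul_of_graph (by norm_cast; positivity) (It.isUnit_scale s0) (Iu.isUnit_scale r0)
      g1 g2 ?_ (hX s)
    -- By normality the second relation reads `s n_s(t) z w = r n_r(u) w z`, and `r/s = p²`.
    have h := rel2
    rw [scaled, scaled, cz, cw, smul_mul_assoc, smul_mul_assoc] at h
    have hsC : (s : ℂ) ≠ 0 := by exact_mod_cast s0.ne'
    have h2 := congrArg (fun m => (s : ℂ)⁻¹ • m) h
    simp only [inv_smul_smul₀ hsC, smul_smul] at h2
    have hc : (s : ℂ)⁻¹ * (r : ℂ) = ((p ^ 2 : ℝ) : ℂ) := by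
      rw [← Complex.ofReal_inv, ← Complex.ofReal_mul, hs, hr]
      congr 1
      field_simp
    rw [← mul_assoc, h2, hc, mul_assoc]
  · refine eq_smul_of_graph (by norm_cast; positivity) (It.isUnit_scale s0') (Iu.isUnit_scale r0)
      g3 (by rwa [Dw'] at g4) ?_ (hX s⁻¹)
    -- The first relation reads `z w* = rs n_r(u) w* n_s(t) z`; multiplying by `n_{1/s}(t)` cancels
    -- `n_s(t)` across `w*` by `i5'`.
    have hc : (r : ℂ) * (s : ℂ) = ((q ^ 2 : ℝ) : ℂ) := by
      rw [← Complex.ofReal_mul, hs, hr]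
      congr 1
      field_simp
    rw [rel1, scaled, scaled, nw', star_star, cz, cw', smul_mul_smul_comm, hc, mul_smul_comm]
    congr 1
    rw [mul_assoc (scale r (star w * w)), ← mul_assoc, (cNK _ _).eq, mul_assoc, ← mul_assoc (star w),
      ← mul_assoc (scale s⁻¹ (star z * z)), ← mul_assoc (scale s⁻¹ (star z * z)), i5']

end
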